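/- Let $K$ be a field and $d$ a positive integer. If $\operatorname{char}K=p>0$, write $d=d'i$ with $i$ a power of $p$ and $d'$ prime to $p$; if $\operatorname{char}K=0$, put $d'=d$, $i=1$. Assume that $K$ contains all $d'$-th roots of unity. In the polynomial ring $R=K[s,f,s_1,f_1,c_1,\dots,c_4,b_1,\dots,b_4]$ let $$J(1,d)=\bigl(s_1-sc_1,\ f_1-sc_4\bigr)+\bigl(c_j(s-fb_j^d) : j=1,2,3,4\bigr)+\bigl(fc_1-sc_2,\ fc_4-sc_3,\ s(c_3-c_2),\ f(c_2b_1-c_3b_4),\ fc_2(b_2-b_3)\bigr).$$ Then $$\sqrt{J(1,d)}=J(1,d)+fb_3\bigl(c_3-c_2,\ c_2(b_1^{d'}-b_2^{d'})\bigr),$$ and this ideal is the intersection of the radicals of the following ideals, where $\mathfrak a=(s_1-sc_1,\,f_1-sc_4)$ and $\alpha$ runs over the $d'$-th roots of unity in $K$: $$\begin{aligned} Q_1&=\mathfrak a+(c_1,c_2,c_3,c_4),\\ Q_{2,\alpha}&=\mathfrak a+(c_4-c_1,\ c_3-c_2,\ c_1-c_2b_1^d,\ s-fb_1^d,\ b_1-b_4,\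 b_2-b_3,\ b_1^i-\alpha b_2^i),\\ Q_3&=\mathfrak a+(s,f),\\ Q_4&=\mathfrak a+(s,c_1,c_2,c_4,b_3^d,b_4),\\ Q_5&=\mathfrak a+(s,c_1,c_4,b_3^d,b_2-b_3,c_2b_1-c_3b_4),\\ Q_6&=\mathfrak a+\bigl(s^2,f^2,c_4(s-fb_4^d),c_3(s-fb_3^d),sc_3-fc_4,c_3^2,c_4^2,c_1-c_4,c_2-c_3,b_2-b_3,b_1-b_4\bigr). \end{aligned}$$ -/

import Mathlib

open MvPolynomial

namespace MayrMeyer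

/-- The twelve indeterminates `s, f, s₁, f₁, c₁, …, c₄, b₁, …, b₄`. -/
inductive Var : Type
  | s | f | s1 | f1 | c1 | c2 | c3 | c4 | b1 | b2 | b3 | b4

open Var

/-- The first Mayr-Meyer ideal `J(1,d)` in `K[s, f, s₁, f₁, c₁, …, c₄, b₁, …, b₄]`. -/
noncomputable def J (K : Type*) [Field K] (d : ℕ) : Ideal (MvPolynomial Var K) :=
  Ideal.span
    { X s1 - X s * X c1,
      X f1 - X s * X c4,
      X c1 * (X s - X f * X b1 ^ d),
      X c2 * (X s - X f * X b2 ^ d),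
      X c3 * (X s - X f * X b3 ^ d),
      X c4 * (X s - X f * X b4 ^ d),
      X f * X c1 - X s * X c2,
      X f * X c4 - X s * X c3,
      X s * (X c3 - X c2),
      X f * (X c2 * X b1 - X c3 * X b4),
      X f * X c2 * (X b2 - X b3) }

/-- The component `Q₁` of `J(1,d)`. -/
noncomputable def Q1 (K : Type*) [Field K] : Ideal (MvPolynomial Var K) :=
  Ideal.span { X s1 - X s * X c1, X f1 - X s * X c4, X c1, X c2, X c3, X c4 }

/-- The component `Q₂(α)` of `J(1,d)`, where `α` is a root of unity and `i` is the largest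
power of the characteristic exponent that divides `d`. -/
noncomputable def Q2 (K : Type*) [Field K] (d i : ℕ) (α : K) : Ideal (MvPolynomial Var K) :=
  Ideal.span
    { X s1 - X s * X c1,
      X f1 - X s * X c4,
      X c4 - X c1,
      X c3 - X c2,
      X c1 - X c2 * X b1 ^ d,
      X s - X f * X b1 ^ d,
      X b1 - X b4,
      X b2 - X b3,
      X b1 ^ i - C α * X b2 ^ i }

/-- The component `Q₃` of `J(1,d)`. -/
noncomputable def Q3 (K : Type*) [Field K] : Ideal (MvPolynomial Var K) :=
  Ideal.span { X s1 - X s * X c1, X f1 - X s * X c4, X s, X f }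

/-- The component `Q₄` of `J(1,d)`. -/
noncomputable def Q4 (K : Type*) [Field K] (d : ℕ) : Ideal (MvPolynomial Var K) :=
  Ideal.span
    { X s1 - X s * X c1, X f1 - X s * X c4, X s, X c1, X c2, X c4, X b3 ^ d, X b4 }

/-- The component `Q₅` of `J(1,d)`. -/
noncomputable def Q5 (K : Type*) [Field K] (d : ℕ) : Ideal (MvPolynomial Var K) :=
  Ideal.span
    { X s1 - X s * X c1, X f1 - X s * X c4, X s, X c1, X c4, X b3 ^ d, X b2 - X b3,
      X c2 * X b1 - X c3 * X b4 }

/-- The (embedded) component `Q₆` of `J(1,d)`. -/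
noncomputable def Q6 (K : Type*) [Field K] (d : ℕ) : Ideal (MvPolynomial Var K) :=
  Ideal.span
    { X s1 - X s * X c1,
      X f1 - X s * X c4,
      X s ^ 2,
      X f ^ 2,
      X c4 * (X s - X f * X b4 ^ d),
      X c3 * (X s - X f * X b3 ^ d),
      X s * X c3 - X f * X c4,
      X c3 ^ 2,
      X c4 ^ 2,
      X c1 - X c4,
      X c2 - X c3,
      X b2 - X b3,
      X b1 - X b4 }

end MayrMeyer

/-! For the intersection formula, a prime $P$ containing $J(1,d)$ gives a point of $J(1,d)$ in the
domain $R/P$. Cancelling nonzero coordinates places that point on one of $Q_1$, $Q_{2,\alpha}$,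
$Q_3$, $Q_4$, $Q_5$; the roots of unity enter by factoring $b_1^d=b_2^d$. Primes over $Q_6$ contain
$Q_3$, so $Q_6$ does not change the intersection.

For the generators, an element $g$ of the radical vanishes at every point of $J(1,d)$ with
coordinates in a domain. Modulo the enlarged ideal, $g$ is pushed into smaller and smaller ideals:
$(s,f,s_1,f_1)$, $(fc_2,fc_3)$, $(fc_2)$, $(fc_2b_3)$, and finally $0$. In each reduction after the
first, the multiplier $y$ already extracted satisfies $yX_j\equiv yv_j$ modulo the next ideal for a
suitable test point $v$, so the cofactor may be replaced by its value at $v$ (`mul_sub_aeval_mem`).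
Vanishing of $g$ then controls that value. -/

namespace MayrMeyer

open Var

/-! ### Points of $J(1,d)$ and substitution modulo an ideal. -/

/-- A point `x` with coordinates in the ring `A` satisfies the equations of `J(1,d)`. -/
structure IsZero {A : Type*} [CommRing A] (d : ℕ) (x : Var → A) : Prop where
  eq_s1 : x s1 - x s * x c1 = 0
  eq_f1 : x f1 - x s * x c4 = 0
  eq_c1 : x c1 * (x s - x f * x b1 ^ d) = 0
  eq_c2 : x c2 * (x s - x f * x b2 ^ d) = 0
  eq_c3 : x c3 * (x s - x f * x b3 ^ d) = 0
  eq_c4 : x c4 * (x s - x f * x b4 ^ d) = 0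
  eq_fc1 : x f * x c1 - x s * x c2 = 0
  eq_fc4 : x f * x c4 - x s * x c3 = 0
  eq_sc : x s * (x c3 - x c2) = 0
  eq_fb : x f * (x c2 * x b1 - x c3 * x b4) = 0
  eq_fcb : x f * x c2 * (x b2 - x b3) = 0

theorem isZero_of_J_le {K : Type*} [Field K] {d : ℕ} {A : Type*} [CommRing A]
    {φ : MvPolynomial Var K →+* A} (h : J K d ≤ RingHom.ker φ) :
    IsZero d (fun v => φ (X v)) := by
  simp only [J, Ideal.span_le, Set.insert_subset_iff, Set.singleton_subset_iff, SetLike.mem_coe,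
    RingHom.mem_ker, map_sub, map_mul, map_pow] at h
  obtain ⟨h1, h2, h3, h4, h5, h6, h7, h8, h9, h10, h11⟩ := h
  exact ⟨h1, h2, h3, h4, h5, h6, h7, h8, h9, h10, h11⟩

theorem J_le_ker {K : Type*} [Field K] {d : ℕ} {A : Type*} [CommRing A]
    {φ : MvPolynomial Var K →+* A} (h : IsZero d (fun v => φ (X v))) :
    J K d ≤ RingHom.ker φ := by
  simp only [J, Ideal.span_le, Set.insert_subset_iff, Set.singleton_subset_iff, SetLike.mem_coe,
    RingHom.mem_ker, map_sub, map_mul, map_pow]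
  exact ⟨h.eq_s1, h.eq_f1, h.eq_c1, h.eq_c2, h.eq_c3, h.eq_c4, h.eq_fc1, h.eq_fc4, h.eq_sc,
    h.eq_fb, h.eq_fcb⟩

/-- If `y * X i` and `y * v i` agree modulo `N` for all `i`, then substituting `v` in `w` does not
change `y * w` modulo `N`. -/
theorem mul_sub_aeval_mem {σ R : Type*} [CommRing R] (N : Ideal (MvPolynomial σ R))
    (y : MvPolynomial σ R) (v : σ → MvPolynomial σ R) (h : ∀ i, y * (X i - v i) ∈ N)
    (w : MvPolynomial σ R) : y * (w - aeval v w) ∈ N := by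
  induction w using MvPolynomial.induction_on with
  | C a => simp
  | add p q hp hq =>
    convert N.add_mem hp hq using 1
    simp only [map_add]; ring
  | mul_X p i hp =>
    convert N.add_mem (N.mul_mem_right (X i) hp) (N.mul_mem_left (aeval v p) (h i)) using 1
    simp only [map_mul, aeval_X]; ring

theorem sub_aeval_mem {σ R : Type*} [CommRing R] (N : Ideal (MvPolynomial σ R))
    (v : σ → MvPolynomial σ R) (h : ∀ i, X i - v i ∈ N)
    (w : MvPolynomial σ R) : w - aeval v w ∈ N := by
  simpa using mul_sub_aeval_mem N 1 v (by simpa using h) w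

/-- The image of `ζ` is still primitive, so every $n$-th root of unity of the domain `A` is a power
of it and already comes from `K`. -/
theorem pow_sub_pow_eq_prod_algebraMap {K A : Type*} [Field K] [CommRing A] [IsDomain A]
    [Algebra K A] {n : ℕ} (hn : 0 < n) {ζ : K} (hζ : IsPrimitiveRoot ζ n) (y z : A) :
    y ^ n - z ^ n = ∏ α ∈ Polynomial.nthRootsFinset n (1 : K), (y - algebraMap K A α * z) := by
  have hinj : Function.Injective (algebraMap K A) := (algebraMap K A).injective
  have hA := hζ.map_of_injective hinj
  rw [hA.pow_sub_pow_eq_prod_sub_mul y z hn]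
  refine (Finset.prod_nbij (algebraMap K A)
    (fun a ha => Polynomial.map_mem_nthRootsFinset_one ha _)
    (fun a _ b _ H => hinj H) (fun a ha => ?_) (fun _ _ => rfl)).symm
  have : NeZero n := ⟨hn.ne'⟩
  obtain ⟨k, -, hk⟩ := hA.eq_pow_of_pow_eq_one
    ((Polynomial.mem_nthRootsFinset hn (1 : A)).1 ha)
  refine ⟨ζ ^ k, ?_, by simpa using hk⟩
  rw [Finset.mem_coe, Polynomial.mem_nthRootsFinset hn, ← pow_mul, mul_comm, pow_mul,
    hζ.pow_eq_one, one_pow]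

/-! ### Minimal components and the intersection formula. -/

section Domain

variable {K : Type*} [Field K] {A : Type*} [CommRing A] [IsDomain A] [Algebra K A]

/-- The equations of the minimal components, for a point of `J(1,d)` with coordinates in a
domain. -/
theorem IsZero.components {d d' i : ℕ} (hd : d = d' * i) (hd0 : 0 < d) {ζ : K}
    (hζ : IsPrimitiveRoot ζ d') {x : Var → A} (h : IsZero d x) :
    (x c1 = 0 ∧ x c2 = 0 ∧ x c3 = 0 ∧ x c4 = 0) ∨
    (∃ α : K, α ^ d' = 1 ∧ x c4 - x c1 = 0 ∧ x c3 - x c2 = 0 ∧ x c1 - x c2 * x b1 ^ d = 0 ∧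
      x s - x f * x b1 ^ d = 0 ∧ x b1 - x b4 = 0 ∧ x b2 - x b3 = 0 ∧
      x b1 ^ i - algebraMap K A α * x b2 ^ i = 0) ∨
    (x s = 0 ∧ x f = 0) ∨
    (x s = 0 ∧ x c1 = 0 ∧ x c2 = 0 ∧ x c4 = 0 ∧ x b3 ^ d = 0 ∧ x b4 = 0) ∨
    (x s = 0 ∧ x c1 = 0 ∧ x c4 = 0 ∧ x b3 ^ d = 0 ∧ x b2 - x b3 = 0 ∧
      x c2 * x b1 - x c3 * x b4 = 0) := by
  obtain ⟨-, -, h1, h2, h3, h4, h5, h6, h7, h8, h9⟩ := h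
  by_cases hs : x s = 0
  · by_cases hf : x f = 0
    · exact .inr (.inr (.inl ⟨hs, hf⟩))
    simp only [hs, hf, zero_sub, zero_mul, sub_zero, mul_eq_zero, false_or, neg_eq_zero] at *
    by_cases hc2 : x c2 = 0
    · by_cases hc3 : x c3 = 0
      · exact .inl ⟨h5, hc2, hc3, h6⟩
      · simp only [hc2, hc3, zero_mul, zero_sub, neg_eq_zero, mul_eq_zero, false_or] at *
        exact .inr (.inr (.inr (.inl ⟨trivial, h5, trivial, h6, h3, h8⟩)))
    · simp only [hc2, false_or] at *
      have hb : x b2 = x b3 := sub_eq_zero.1 h9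
      exact .inr (.inr (.inr (.inr ⟨trivial, h5, h6, hb ▸ h2, h9, h8⟩)))
  · have h32 : x c3 = x c2 := by
      rcases mul_eq_zero.1 h7 with h | h
      · exact absurd h hs
      · exact sub_eq_zero.1 h
    by_cases hc2 : x c2 = 0
    · simp only [h32, hc2, mul_zero, sub_zero] at *
      by_cases hf : x f = 0
      · simp only [hf, zero_mul, sub_zero, mul_eq_zero, hs, or_false] at *
        exact .inl ⟨h1, trivial, trivial, h4⟩
      · simp only [mul_eq_zero, hf, false_or] at h5 h6
        exact .inl ⟨h5, trivial, trivial, h6⟩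
    have hf : x f ≠ 0 := by
      intro hf
      simp [hf, hs, hc2] at h5
    have h41 : x c4 = x c1 := by
      apply mul_left_cancel₀ hf
      linear_combination h6 - h5 + x s * h32
    have hb23 : x b2 - x b3 = 0 := by simpa [hf, hc2] using h9
    have hb14 : x b1 - x b4 = 0 := by
      apply mul_left_cancel₀ (mul_ne_zero hf hc2)
      linear_combination h8 + x f * x b4 * h32
    have hs2 : x s - x f * x b2 ^ d = 0 := by simpa [hc2] using h2
    have hc1 : x c1 ≠ 0 := by
      intro hc1
      simp [hc1, hs, hc2] at h5
    have hs1 : x s - x f * x b1 ^ d = 0 := by simpa [hc1] using h1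
    have hc12 : x c1 - x c2 * x b1 ^ d = 0 := by
      apply mul_left_cancel₀ hf
      linear_combination h5 + x c2 * hs1
    -- Both $fb_1^d$ and $fb_2^d$ equal $s$, and $f\ne0$.
    have hbd : (x b1 ^ i) ^ d' - (x b2 ^ i) ^ d' = 0 := by
      rw [← pow_mul, ← pow_mul, mul_comm i, ← hd]
      apply mul_left_cancel₀ hf
      linear_combination hs2 - hs1
    have hd'0 : 0 < d' := Nat.pos_of_ne_zero (by rintro rfl; simp at hd; omega)
    rw [pow_sub_pow_eq_prod_algebraMap hd'0 hζ, Finset.prod_eq_zero_iff] at hbd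
    obtain ⟨α, hα, hb⟩ := hbd
    exact .inr (.inl ⟨α, (Polynomial.mem_nthRootsFinset hd'0 _).1 hα, sub_eq_zero.2 h41,
      sub_eq_zero.2 h32, hc12, hs1, hb14, hb23, hb⟩)

end Domain

/-- Every prime ideal that contains `J(1,d)` contains one of its minimal components. -/
theorem component_le_of_J_le {K : Type*} [Field K] {d d' i : ℕ} (hd : d = d' * i) (hd0 : 0 < d)
    {ζ : K} (hζ : IsPrimitiveRoot ζ d') {P : Ideal (MvPolynomial Var K)} [P.IsPrime]
    (h : J K d ≤ P) :
    Q1 K ≤ P ∨ (∃ α : K, α ^ d' = 1 ∧ Q2 K d i α ≤ P) ∨ Q3 K ≤ P ∨ Q4 K d ≤ P ∨ Q5 K d ≤ P := by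
  have hP : RingHom.ker (Ideal.Quotient.mk P) = P := Ideal.mk_ker
  have hz := isZero_of_J_le (h.trans hP.ge)
  have hs1 := hz.eq_s1
  have hf1 := hz.eq_f1
  have hc := hz.components hd hd0 hζ
  have hC : ∀ α, Ideal.Quotient.mk P (C α) = algebraMap K _ α := fun _ => rfl
  rw [← hP]
  simp only [Q1, Q2, Q3, Q4, Q5, Ideal.span_le, Set.insert_subset_iff, Set.singleton_subset_iff,
    SetLike.mem_coe, RingHom.mem_ker, map_sub, map_mul, map_pow, hs1, hf1, true_and, hC]
  exact hc

/-- Conversely to `IsZero.components`, the points of the components satisfy the equations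
of `J(1,d)`. -/
theorem isZero_of_components {K A : Type*} [Field K] [CommRing A] [IsDomain A] [Algebra K A]
    {d d' i : ℕ} (hd : d = d' * i) (hd0 : 0 < d) {x : Var → A}
    (hs1 : x s1 - x s * x c1 = 0) (hf1 : x f1 - x s * x c4 = 0)
    (h : (x c1 = 0 ∧ x c2 = 0 ∧ x c3 = 0 ∧ x c4 = 0) ∨
    (∃ α : K, α ^ d' = 1 ∧ x c4 - x c1 = 0 ∧ x c3 - x c2 = 0 ∧ x c1 - x c2 * x b1 ^ d = 0 ∧
      x s - x f * x b1 ^ d = 0 ∧ x b1 - x b4 = 0 ∧ x b2 - x b3 = 0 ∧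
      x b1 ^ i - algebraMap K A α * x b2 ^ i = 0) ∨
    (x s = 0 ∧ x f = 0) ∨
    (x s = 0 ∧ x c1 = 0 ∧ x c2 = 0 ∧ x c4 = 0 ∧ x b3 ^ d = 0 ∧ x b4 = 0) ∨
    (x s = 0 ∧ x c1 = 0 ∧ x c4 = 0 ∧ x b3 ^ d = 0 ∧ x b2 - x b3 = 0 ∧
      x c2 * x b1 - x c3 * x b4 = 0)) : IsZero d x := by
  rcases h with ⟨h1, h2, h3, h4⟩ | ⟨α, hα, h1, h2, h3, h4, h5, h6, h7⟩ | ⟨h1, h2⟩ |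
    ⟨h1, h2, h3, h4, h5, h6⟩ | ⟨h1, h2, h3, h4, h5, h6⟩
  · exact ⟨hs1, hf1, by simp [*], by simp [*], by simp [*], by simp [*], by simp [*], by simp [*],
      by simp [*], by simp [*], by simp [*]⟩
  · have hb : x b1 ^ d = x b2 ^ d := by
      rw [hd, mul_comm d', pow_mul, pow_mul, sub_eq_zero.1 h7, mul_pow, ← map_pow, hα, map_one,
        one_mul]
    rw [sub_eq_zero] at h1 h2 h3 h4 h5 h6
    have hb' : x b1 ^ d = x b3 ^ d := by rw [hb, h6]
    refine ⟨hs1, hf1, ?_, ?_, ?_, ?_, ?_, ?_, ?_, ?_, ?_⟩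
    · rw [h4]; ring
    · rw [h4, hb]; ring
    · rw [h4, hb']; ring
    · rw [← h5, h4]; ring
    · rw [h3, h4]; ring
    · rw [h1, h2, h3, h4]; ring
    · rw [h2]; ring
    · rw [← h5, h2]; ring
    · rw [h6]; ring
  · exact ⟨hs1, hf1, by simp [*], by simp [*], by simp [*], by simp [*], by simp [*], by simp [*],
      by simp [*], by simp [*], by simp [*]⟩
  · have h7 := (pow_eq_zero_iff hd0.ne').1 h5
    have hd0' := hd0.ne'
    clear hd h5
    exact ⟨hs1, hf1, by simp [*], by simp [*], by simp [*], by simp [*], by simp [*], by simp [*],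
      by simp [*], by simp [*], by simp [*]⟩
  · rw [sub_eq_zero] at h5
    have h7 := (pow_eq_zero_iff hd0.ne').1 h4
    have hd0' := hd0.ne'
    clear hd h4
    exact ⟨hs1, hf1, by simp [*], by simp [*], by simp [*], by simp [*], by simp [*], by simp [*],
      by simp [*], by simp [*], by simp [*]⟩

/-- Pulls out the two generators of $\mathfrak a$, which all components share. -/
theorem and_components_distrib {ι : Type*} {a b q1 q3 q4 q5 : Prop} {u q2 : ι → Prop}
    (h : (a ∧ b ∧ q1) ∨ (∃ α, u α ∧ a ∧ b ∧ q2 α) ∨ (a ∧ b ∧ q3) ∨ (a ∧ b ∧ q4) ∨ (a ∧ b ∧ q5)) :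
    (a ∧ b) ∧ (q1 ∨ (∃ α, u α ∧ q2 α) ∨ q3 ∨ q4 ∨ q5) := by
  rcases h with ⟨ha, hb, h⟩ | ⟨α, hu, ha, hb, h⟩ | ⟨ha, hb, h⟩ | ⟨ha, hb, h⟩ | ⟨ha, hb, h⟩
  · exact ⟨⟨ha, hb⟩, .inl h⟩
  · exact ⟨⟨ha, hb⟩, .inr (.inl ⟨α, hu, h⟩)⟩
  · exact ⟨⟨ha, hb⟩, .inr (.inr (.inl h))⟩
  · exact ⟨⟨ha, hb⟩, .inr (.inr (.inr (.inl h)))⟩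
  · exact ⟨⟨ha, hb⟩, .inr (.inr (.inr (.inr h)))⟩

theorem J_le_of_component_le {K : Type*} [Field K] {d d' i : ℕ} (hd : d = d' * i) (hd0 : 0 < d)
    {P : Ideal (MvPolynomial Var K)} [P.IsPrime]
    (h : Q1 K ≤ P ∨ (∃ α : K, α ^ d' = 1 ∧ Q2 K d i α ≤ P) ∨ Q3 K ≤ P ∨ Q4 K d ≤ P ∨ Q5 K d ≤ P) :
    J K d ≤ P := by
  have hP : RingHom.ker (Ideal.Quotient.mk P) = P := Ideal.mk_ker
  have hC : ∀ α, Ideal.Quotient.mk P (C α) = algebraMap K _ α := fun _ => rfl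
  rw [← hP] at h ⊢
  simp only [Q1, Q2, Q3, Q4, Q5, Ideal.span_le, Set.insert_subset_iff, Set.singleton_subset_iff,
    SetLike.mem_coe, RingHom.mem_ker, map_sub, map_mul, map_pow, hC] at h
  apply J_le_ker
  obtain ⟨hs1, hf1, h⟩ := and_assoc.1 (and_components_distrib h)
  exact isZero_of_components hd hd0 hs1 hf1 h

theorem Q3_le_of_Q6_le {K : Type*} [Field K] {d : ℕ} {P : Ideal (MvPolynomial Var K)} [P.IsPrime]
    (h : Q6 K d ≤ P) : Q3 K ≤ P := by
  have hP : P.IsPrime := inferInstance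
  simp only [Q3, Q6, Ideal.span_le, Set.insert_subset_iff, Set.singleton_subset_iff,
    SetLike.mem_coe] at h ⊢
  obtain ⟨h1, h2, h3, h4, -⟩ := h
  exact ⟨h1, h2, hP.mem_of_pow_mem _ h3, hP.mem_of_pow_mem _ h4⟩

theorem le_radical_of_forall_prime {R : Type*} [CommRing R] {I J : Ideal R}
    (h : ∀ P : Ideal R, P.IsPrime → J ≤ P → I ≤ P) : I ≤ J.radical := by
  rw [Ideal.radical_eq_sInf]
  exact le_sInf fun P hP => h P hP.2 hP.1

theorem radical_J_eq_inf {K : Type*} [Field K] {d d' i : ℕ} (hd : d = d' * i) (hd0 : 0 < d)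
    {ζ : K} (hζ : IsPrimitiveRoot ζ d') :
    (J K d).radical = (Q1 K).radical ⊓
      (⨅ α : {α : K // α ^ d' = 1}, (Q2 K d i α.1).radical) ⊓ (Q3 K).radical ⊓
        (Q4 K d).radical ⊓ (Q5 K d).radical ⊓ (Q6 K d).radical := by
  apply le_antisymm
  · simp only [le_inf_iff, le_iInf_iff, Ideal.radical_le_radical_iff]
    refine ⟨⟨⟨⟨⟨?_, fun α => ?_⟩, ?_⟩, ?_⟩, ?_⟩, ?_⟩ <;>
      refine le_radical_of_forall_prime fun P hP h =>
        J_le_of_component_le (d' := d') (i := i) hd hd0 ?_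
    · exact .inl h
    · exact .inr (.inl ⟨α.1, α.2, h⟩)
    · exact .inr (.inr (.inl h))
    · exact .inr (.inr (.inr (.inl h)))
    · exact .inr (.inr (.inr (.inr h)))
    · exact .inr (.inr (.inl (Q3_le_of_Q6_le h)))
  · refine le_radical_of_forall_prime fun P hP h x hx => ?_
    simp only [Submodule.mem_inf, Submodule.mem_iInf] at hx
    obtain ⟨⟨⟨⟨⟨h1, h2⟩, h3⟩, h4⟩, h5⟩, -⟩ := hx
    rcases component_le_of_J_le hd hd0 hζ h with h | ⟨α, hα, h⟩ | h | h | h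
    · exact hP.radical_le_iff.2 h h1
    · exact hP.radical_le_iff.2 h (h2 ⟨α, hα⟩)
    · exact hP.radical_le_iff.2 h h3
    · exact hP.radical_le_iff.2 h h4
    · exact hP.radical_le_iff.2 h h5

/-! ### The enlarged ideal lies in the radical. -/

/-- The ideal `J(1,d) + f b₃ (c₃ - c₂, c₂ (b₁^d' - b₂^d'))`. -/
noncomputable def reducedJ (K : Type*) [Field K] (d d' : ℕ) : Ideal (MvPolynomial Var K) :=
  J K d + Ideal.span {X f * X b3} * Ideal.span {X c3 - X c2, X c2 * (X b1 ^ d' - X b2 ^ d')}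

theorem reducedJ_le_iff {K : Type*} [Field K] {d d' : ℕ} {N : Ideal (MvPolynomial Var K)} :
    reducedJ K d d' ≤ N ↔ J K d ≤ N ∧ X f * X b3 * (X c3 - X c2) ∈ N ∧
      X f * X b3 * (X c2 * (X b1 ^ d' - X b2 ^ d')) ∈ N := by
  rw [reducedJ, Submodule.add_eq_sup, sup_le_iff, Ideal.span_mul_span', Ideal.span_le]
  simp [Set.insert_subset_iff, Set.singleton_mul]

/-- Checked on each component in a domain; only $Q_{2,\alpha}$ is not immediate. There
$b_1^d=b_2^d$, and Frobenius turns this into $(b_1^{d'}-b_2^{d'})^{p^e}=0$. The exponential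
characteristic $p=1$ covers characteristic $0$. -/
theorem reducedJ_le_radical {K : Type*} [Field K] (p : ℕ) [ExpChar K p] {d d' e : ℕ}
    (hd : d = d' * p ^ e) (hd0 : 0 < d) {ζ : K} (hζ : IsPrimitiveRoot ζ d') :
    reducedJ K d d' ≤ (J K d).radical := by
  refine le_radical_of_forall_prime fun P hP h => reducedJ_le_iff.2 ⟨h, ?_⟩
  have hP' : RingHom.ker (Ideal.Quotient.mk P) = P := Ideal.mk_ker
  have hz := (isZero_of_J_le (h.trans hP'.ge)).components hd hd0 hζ
  have : ExpChar (MvPolynomial Var K ⧸ P) p :=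
    expChar_of_injective_algebraMap (algebraMap K (MvPolynomial Var K ⧸ P)).injective p
  simp only [← Ideal.Quotient.eq_zero_iff_mem, map_mul, map_sub, map_pow]
  rcases hz with ⟨h1, h2, h3, h4⟩ | ⟨α, hα, h1, h2, h3, h4, h5, h6, h7⟩ | ⟨h1, h2⟩ |
    ⟨h1, h2, h3, h4, h5, h6⟩ | ⟨h1, h2, h3, h4, h5, h6⟩
  · simp [h2, h3]
  · have hb : (Ideal.Quotient.mk P (X b1)) ^ d' - (Ideal.Quotient.mk P (X b2)) ^ d' = 0 := by
      rw [← pow_eq_zero_iff (expChar_pow_pos K p e).ne', sub_pow_expChar_pow, ← pow_mul, ← pow_mul,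
        mul_comm d', pow_mul, sub_eq_zero.1 h7, mul_pow, ← map_pow, hα, map_one, one_mul, pow_mul,
        sub_self]
    rw [h2, hb]
    simp
  · simp [h2]
  · simp [(pow_eq_zero_iff hd0.ne').1 h5]
  · simp [(pow_eq_zero_iff hd0.ne').1 h4]

theorem aeval_eq_zero_of_mem_radical {K A : Type*} [Field K] [CommRing A] [IsDomain A]
    [Algebra K A] {d : ℕ} {v : Var → A} (hv : IsZero d v) {g : MvPolynomial Var K}
    (hg : g ∈ (J K d).radical) : aeval v g = 0 := by
  have h : J K d ≤ RingHom.ker (aeval v : MvPolynomial Var K →ₐ[K] A).toRingHom :=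
    J_le_ker (by simpa using hv)
  have := RingHom.ker_isPrime (aeval v : MvPolynomial Var K →ₐ[K] A).toRingHom
  exact (Ideal.IsPrime.radical_le_iff this).2 h hg

/-! ### Test points for the successive reductions. -/

/-- The point `c₁ = c₂ = c₃ = c₄ = 0`. -/
noncomputable def cZero (R : Type*) [CommRing R] : Var → MvPolynomial Var R
  | s => X s | f => X f | s1 => 0 | f1 => 0 | c1 => 0 | c2 => 0 | c3 => 0 | c4 => 0
  | b1 => X b1 | b2 => X b2 | b3 => X b3 | b4 => X b4

/-- The point `s = f = 0`. -/
noncomputable def sfZero (R : Type*) [CommRing R] : Var → MvPolynomial Var R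
  | s => 0 | f => 0 | s1 => 0 | f1 => 0 | c1 => X c1 | c2 => X c2 | c3 => X c3 | c4 => X c4
  | b1 => X b1 | b2 => X b2 | b3 => X b3 | b4 => X b4

/-- The point `s = c₁ = c₂ = c₄ = b₃ = b₄ = 0`. -/
noncomputable def bZero (R : Type*) [CommRing R] : Var → MvPolynomial Var R
  | s => 0 | f => X f | s1 => 0 | f1 => 0 | c1 => 0 | c2 => 0 | c3 => X c3 | c4 => 0
  | b1 => X b1 | b2 => X b2 | b3 => 0 | b4 => 0

/-- The point `s = c₁ = c₄ = b₂ = b₃ = 0`. -/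
noncomputable def bcZero (R : Type*) [CommRing R] : Var → MvPolynomial Var R
  | s => 0 | f => X f | s1 => 0 | f1 => 0 | c1 => 0 | c2 => X c2 | c3 => X c3 | c4 => 0
  | b1 => X b1 | b2 => 0 | b3 => 0 | b4 => X b4

/-- The point `s = f b₃ᵈ`, `c₁ = c₄ = c₂ b₃ᵈ`, `c₃ = c₂`, `b₂ = b₃`, `b₄ = b₁`. -/
noncomputable def generic (R : Type*) [CommRing R] (d : ℕ) : Var → MvPolynomial Var R
  | s => X f * X b3 ^ d | f => X f
  | s1 => X f * X b3 ^ d * (X c2 * X b3 ^ d) | f1 => X f * X b3 ^ d * (X c2 * X b3 ^ d)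
  | c1 => X c2 * X b3 ^ d | c2 => X c2 | c3 => X c2 | c4 => X c2 * X b3 ^ d
  | b1 => X b1 | b2 => X b3 | b3 => X b3 | b4 => X b1

/-- The substitution `b₁ = α b₃`. -/
noncomputable def rotate {R : Type*} [CommRing R] (α : R) : Var → MvPolynomial Var R
  | b1 => C α * X b3 | v => X v

/-! ### Each product of $s$ or $f$ with a $c_j$, except $fc_2$ and $fc_3$, is a multiple of
$fc_2b_3^d$. -/

section Ring

variable {A : Type*} [CommRing A] {d d' : ℕ} {x : Var → A}

theorem IsZero.f_mul_c2_mul_b2_pow (h : IsZero d x) (k : ℕ) :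
    x f * x c2 * x b2 ^ k = x f * x c2 * x b3 ^ k := by
  induction k with
  | zero => simp
  | succ k ih => rw [pow_succ, pow_succ]; linear_combination x b2 * ih + x b3 ^ k * h.eq_fcb

theorem IsZero.s_mul_c2 (h : IsZero d x) : x s * x c2 = x f * x c2 * x b3 ^ d := by
  linear_combination h.eq_c2 + h.f_mul_c2_mul_b2_pow d

theorem IsZero.s_mul_c3 (h : IsZero d x) : x s * x c3 = x f * x c2 * x b3 ^ d := by
  linear_combination h.eq_sc + h.s_mul_c2

theorem IsZero.f_mul_c1 (h : IsZero d x) : x f * x c1 = x f * x c2 * x b3 ^ d := by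
  linear_combination h.eq_fc1 + h.s_mul_c2

theorem IsZero.f_mul_c4 (h : IsZero d x) : x f * x c4 = x f * x c2 * x b3 ^ d := by
  linear_combination h.eq_fc4 + h.s_mul_c3

theorem IsZero.s_mul_c1 (h : IsZero d x) :
    x s * x c1 = x f * x c2 * (x b3 ^ d * x b1 ^ d) := by
  linear_combination h.eq_c1 + x b1 ^ d * h.f_mul_c1

theorem IsZero.s_mul_c4 (h : IsZero d x) :
    x s * x c4 = x f * x c2 * (x b3 ^ d * x b4 ^ d) := by
  linear_combination h.eq_c4 + x b4 ^ d * h.f_mul_c4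

end Ring

/-- Factor theorem, one root at a time: at $b_1=\beta b_3$ an earlier factor becomes
$(\beta-\alpha)b_3\ne0$, so the remaining cofactor must vanish there. -/
theorem prod_dvd_of_aeval_rotate {K : Type*} [Field K] (S : Finset K) {w : MvPolynomial Var K}
    (h : ∀ α ∈ S, aeval (rotate α) w = 0) : ∏ α ∈ S, (X b1 - C α * X b3) ∣ w := by
  classical
  induction S using Finset.induction_on with
  | empty => simp
  | insert β S hβ ih =>
    obtain ⟨q, hq⟩ := ih fun α hα => h α (Finset.mem_insert_of_mem hα)
    have hβq : aeval (rotate β) q = 0 := by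
      have h0 := h β (Finset.mem_insert_self β S)
      rw [hq, map_mul, map_prod, mul_eq_zero, Finset.prod_eq_zero_iff] at h0
      refine h0.resolve_left ?_
      rintro ⟨α, hα, h1⟩
      have h2 : C (β - α) * X b3 = (0 : MvPolynomial Var K) := by
        rw [← h1]; simp [rotate, sub_mul]
      rcases mul_eq_zero.1 h2 with h3 | h3
      · rw [C_eq_zero, sub_eq_zero] at h3
        exact hβ (h3 ▸ hα)
      · exact X_ne_zero _ h3
    have hmem := sub_aeval_mem (Ideal.span {X b1 - C β * X b3}) (rotate β) (fun i => by
      cases i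
      case b1 => exact Ideal.mem_span_singleton_self _
      all_goals simp [rotate]) q
    rw [hβq, sub_zero, Ideal.mem_span_singleton] at hmem
    rw [Finset.prod_insert hβ, mul_comm, hq]
    exact mul_dvd_mul_left _ hmem

/-- It is linear in $c_2$ with relatively prime coefficients $b_1$ and $-c_3b_4$, hence irreducible,
and the polynomial ring is factorial. -/
theorem prime_quadric (K : Type*) [Field K] :
    Prime (X c2 * X b1 - X c3 * X b4 : MvPolynomial Var K) := by
  classical
  rw [← irreducible_iff_prime, mul_comm (X c2), sub_eq_add_neg]
  refine irreducible_mul_X_add _ _ c2 (X_ne_zero _) (by simp [vars_X]) ?_ ?_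
  · rw [vars_neg]
    intro hv
    have := vars_mul _ _ hv
    simp [vars_X] at this
  · rw [IsRelPrime.neg_right_iff, (X_prime (R := K) (i := b1)).irreducible.isRelPrime_iff_not_dvd]
    rintro ⟨q, hq⟩
    have := congrArg (eval (fun v : Var => match v with | b1 => (0 : K) | _ => 1)) hq
    simp at this

/-! ### The radical lies in the enlarged ideal. -/

section Radical

variable {K : Type*} [Field K] {d d' : ℕ} {g : MvPolynomial Var K}

theorem exists_sub_mem_J (hg : g ∈ (J K d).radical) :
    ∃ u v, g - (X f * X c2 * u + X f * X c3 * v) ∈ J K d := by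
  set π := Ideal.Quotient.mk (J K d) with hπ
  have hz : IsZero d (fun v => π (X v)) := isZero_of_J_le Ideal.mk_ker.ge
  -- This is $J(1,d)+(fc_2,fc_3)$, which contains $s_1$, $f_1$ and all $sc_j$, $fc_j$.
  set N : Ideal (MvPolynomial Var K) :=
    (Ideal.span {π (X f * X c2), π (X f * X c3)}).comap π with hN
  have hc2 : X f * X c2 ∈ N := Ideal.subset_span (by simp)
  have hc3 : X f * X c3 ∈ N := Ideal.subset_span (by simp)
  have key : ∀ y z, π y = π (X f * X c2 * z) → y ∈ N := fun y z h => by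
    rw [hN, Ideal.mem_comap, h]
    exact N.mul_mem_right z hc2
  have hs1 : X s1 ∈ N := key _ (X b3 ^ d * X b1 ^ d) (by
    simp only [map_mul, map_pow]
    linear_combination hz.eq_s1 + hz.s_mul_c1)
  have hf1 : X f1 ∈ N := key _ (X b3 ^ d * X b4 ^ d) (by
    simp only [map_mul, map_pow]
    linear_combination hz.eq_f1 + hz.s_mul_c4)
  have hs : ∀ i, X s * (X i - cZero K i) ∈ N := fun i => by
    cases i <;> simp only [cZero, sub_self, mul_zero, sub_zero, zero_mem]
    · exact N.mul_mem_left _ hs1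
    · exact N.mul_mem_left _ hf1
    · exact key _ (X b3 ^ d * X b1 ^ d) (by simpa using hz.s_mul_c1)
    · exact key _ (X b3 ^ d) (by simpa using hz.s_mul_c2)
    · exact key _ (X b3 ^ d) (by simpa using hz.s_mul_c3)
    · exact key _ (X b3 ^ d * X b4 ^ d) (by simpa using hz.s_mul_c4)
  have hf : ∀ i, X f * (X i - cZero K i) ∈ N := fun i => by
    cases i <;> simp only [cZero, sub_self, mul_zero, sub_zero, zero_mem]
    · exact N.mul_mem_left _ hs1
    · exact N.mul_mem_left _ hf1
    · exact key _ (X b3 ^ d) (by simpa using hz.f_mul_c1)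
    · exact hc2
    · exact hc3
    · exact key _ (X b3 ^ d) (by simpa using hz.f_mul_c4)
  -- All of $s=f=s_1=f_1=0$ consists of points of $J(1,d)$.
  have hspan : g ∈ Ideal.span {X s, X f, X s1, X f1} := by
    have h := sub_aeval_mem (Ideal.span {X s, X f, X s1, X f1}) (sfZero K) (fun i => by
      cases i <;> simp only [sfZero, sub_self, sub_zero, zero_mem] <;>
        exact Ideal.subset_span (by simp)) g
    rwa [aeval_eq_zero_of_mem_radical (by constructor <;> simp [sfZero]) hg, sub_zero] at h
  obtain ⟨a, y, hy, rfl⟩ := Ideal.mem_span_insert.1 hspan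
  obtain ⟨b, y', hy', rfl⟩ := Ideal.mem_span_insert.1 hy
  obtain ⟨c, e, rfl⟩ := Ideal.mem_span_pair.1 hy'
  have h0 : aeval (cZero K) (a * X s + (b * X f + (c * X s1 + e * X f1))) = 0 :=
    aeval_eq_zero_of_mem_radical (by constructor <;> simp [cZero]) hg
  -- Modulo `N` the cofactors of $s$ and $f$ may be evaluated at $c_j=0$, where the resulting
  -- combination is zero by `h0`.
  have hgN : a * X s + (b * X f + (c * X s1 + e * X f1)) ∈ N := by
    have h := N.add_mem (N.add_mem (mul_sub_aeval_mem N (X s) (cZero K) hs a)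
      (mul_sub_aeval_mem N (X f) (cZero K) hf b))
      (N.add_mem (N.mul_mem_left c hs1) (N.mul_mem_left e hf1))
    convert h using 1
    simp only [map_add, map_mul, aeval_X, cZero, mul_zero, add_zero] at h0
    linear_combination h0
  obtain ⟨u, v, huv⟩ := Ideal.mem_span_pair.1 hgN
  obtain ⟨u, rfl⟩ := Ideal.Quotient.mk_surjective u
  obtain ⟨v, rfl⟩ := Ideal.Quotient.mk_surjective v
  refine ⟨u, v, ?_⟩
  rw [← Ideal.Quotient.eq_zero_iff_mem, map_sub, ← huv]
  simp only [map_add, map_mul]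
  ring

theorem isZero_mk_reducedJ (K : Type*) [Field K] (d d' : ℕ) :
    IsZero d (fun v => Ideal.Quotient.mk (reducedJ K d d') (X v)) :=
  isZero_of_J_le ((reducedJ_le_iff.1 le_rfl).1.trans Ideal.mk_ker.ge)

theorem mk_reducedJ_c3 (K : Type*) [Field K] (d d' : ℕ) :
    Ideal.Quotient.mk (reducedJ K d d') (X f) * Ideal.Quotient.mk (reducedJ K d d') (X b3) *
      (Ideal.Quotient.mk (reducedJ K d d') (X c3) - Ideal.Quotient.mk (reducedJ K d d') (X c2))
        = 0 := by
  simpa using Ideal.Quotient.eq_zero_iff_mem.2 (reducedJ_le_iff.1 (le_refl (reducedJ K d d'))).2.1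

theorem exists_sub_mul_mem_of_mem_comap {y : MvPolynomial Var K}
    {I : Ideal (MvPolynomial Var K)}
    (h : g ∈ (Ideal.span {Ideal.Quotient.mk I y}).comap (Ideal.Quotient.mk I)) :
    ∃ u, g - y * u ∈ I := by
  rw [Ideal.mem_comap, Ideal.mem_span_singleton] at h
  obtain ⟨u, hu⟩ := h
  obtain ⟨u, rfl⟩ := Ideal.Quotient.mk_surjective u
  exact ⟨u, by rw [← Ideal.Quotient.eq_zero_iff_mem, map_sub, hu, map_mul, sub_self]⟩

/-- Elements of the radical are multiples of `f c₂` modulo `reducedJ`. -/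
theorem exists_sub_f_mul_c2_mem (hd0 : 0 < d)
    (hg : g ∈ (J K d).radical) : ∃ u, g - X f * X c2 * u ∈ reducedJ K d d' := by
  obtain ⟨u, v, huv⟩ := exists_sub_mem_J hg
  have hz := isZero_mk_reducedJ K d d'
  have h13 := mk_reducedJ_c3 K d d'
  set π := Ideal.Quotient.mk (reducedJ K d d') with hπ
  set N : Ideal (MvPolynomial Var K) := (Ideal.span {π (X f * X c2)}).comap π with hN
  have hker : ∀ y ∈ reducedJ K d d', y ∈ N := fun y hy => by
    rw [hN, Ideal.mem_comap, Ideal.Quotient.eq_zero_iff_mem.2 hy]; exact zero_mem _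
  have key : ∀ y z, π y = π (X f * X c2 * z) → y ∈ N := fun y z h => by
    rw [hN, Ideal.mem_comap, h, map_mul _ _ z, Ideal.mem_span_singleton]
    exact dvd_mul_right _ _
  -- At this point $c_2=0$, so only $fc_3v$ survives, and $fc_3$ can be cancelled.
  have hv : aeval (bZero K) v = 0 := by
    have h := (J K d).radical.sub_mem hg (Ideal.le_radical huv)
    have h0 := aeval_eq_zero_of_mem_radical
      (v := bZero K) (by constructor <;> simp [bZero, hd0.ne']) h
    simpa [bZero, X_ne_zero] using h0
  -- The new relation $fb_3c_3=fb_3c_2$ handles $b_3$, and $fc_3b_4=fc_2b_1$ handles $b_4$.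
  have hvN : X f * X c3 * v ∈ N := by
    have h := mul_sub_aeval_mem N (X f * X c3) (bZero K) (fun i => by
      cases i <;> simp only [bZero, sub_self, mul_zero, sub_zero, zero_mem]
      · exact key _ (X f * X b3 ^ d) (by
          simp only [map_mul, map_pow]; linear_combination π (X f) * hz.s_mul_c3)
      · exact key _ (X c3 * X b3 ^ d * X b1 ^ d * X f) (by
          simp only [map_mul, map_pow]
          linear_combination π (X f) * π (X c3) * (hz.eq_s1 + hz.s_mul_c1))
      · exact key _ (X c3 * X b3 ^ d * X b4 ^ d * X f) (by
          simp only [map_mul, map_pow]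
          linear_combination π (X f) * π (X c3) * (hz.eq_f1 + hz.s_mul_c4))
      · exact key _ (X c3 * X b3 ^ d) (by
          simp only [map_mul, map_pow]; linear_combination π (X c3) * hz.f_mul_c1)
      · exact key _ (X c3) (by simp only [map_mul]; ring)
      · exact key _ (X c3 * X b3 ^ d) (by
          simp only [map_mul, map_pow]; linear_combination π (X c3) * hz.f_mul_c4)
      · exact key _ (X b3) (by simp only [map_mul]; linear_combination h13)
      · exact key _ (X b1) (by simp only [map_mul]; linear_combination -hz.eq_fb)) v
    rwa [hv, sub_zero] at h
  apply exists_sub_mul_mem_of_mem_comap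
  have h := N.add_mem (N.add_mem (hker _ ((reducedJ_le_iff.1 (le_refl (reducedJ K d d'))).1 huv)) hvN)
    (key (X f * X c2 * u) u rfl)
  convert h using 1
  ring

/-- Elements of the radical are multiples of `f c₂ b₃` modulo `reducedJ`. -/
theorem exists_sub_f_mul_c2_mul_b3_mem (hd0 : 0 < d) (hI : reducedJ K d d' ≤ (J K d).radical)
    (hg : g ∈ (J K d).radical) : ∃ u, g - X f * X c2 * X b3 * u ∈ reducedJ K d d' := by
  obtain ⟨u, hu⟩ := exists_sub_f_mul_c2_mem (d' := d') hd0 hg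
  have hz := isZero_mk_reducedJ K d d'
  have h13 := mk_reducedJ_c3 K d d'
  set π := Ideal.Quotient.mk (reducedJ K d d') with hπ
  set N : Ideal (MvPolynomial Var K) := (Ideal.span {π (X f * X c2 * X b3)}).comap π with hN
  have hker : ∀ y ∈ reducedJ K d d', y ∈ N := fun y hy => by
    rw [hN, Ideal.mem_comap, Ideal.Quotient.eq_zero_iff_mem.2 hy]; exact zero_mem _
  have key : ∀ y z, π y = π (X f * X c2 * X b3 * z) → y ∈ N := fun y z h => by
    rw [hN, Ideal.mem_comap, h, map_mul _ _ z, Ideal.mem_span_singleton]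
    exact dvd_mul_right _ _
  -- Lets one factor $b_3$ be taken out of $b_3^d$.
  obtain ⟨k, rfl⟩ : ∃ k, d = k + 1 := ⟨d - 1, by omega⟩
  have hq := prime_quadric K
  -- `bcZero` satisfies the equations only modulo the quadric, so $fc_2u$ there is a multiple of
  -- this prime. With all variables equal to $1$ the quadric is $0$ and $fc_2$ is $1$, so the prime
  -- divides $u$ at `bcZero`.
  have hdvd : X c2 * X b1 - X c3 * X b4 ∣ aeval (bcZero K) u := by
    have h := (J K _).radical.sub_mem hg (hI hu)
    have hle : J K (k + 1) ≤ (Ideal.span {X c2 * X b1 - X c3 * X b4}).comap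
        (aeval (bcZero K) : MvPolynomial Var K →ₐ[K] MvPolynomial Var K) := by
      simp only [J, Ideal.span_le, Set.insert_subset_iff, Set.singleton_subset_iff, SetLike.mem_coe,
        Ideal.mem_comap, Ideal.mem_span_singleton]
      simp [bcZero]
    have hprime := (Ideal.span_singleton_prime hq.ne_zero).2 hq
    have h0 := (Ideal.IsPrime.radical_le_iff inferInstance).2 hle h
    rw [Ideal.mem_comap, Ideal.mem_span_singleton] at h0
    simp only [sub_sub_cancel, map_mul, aeval_X, bcZero] at h0
    refine (hq.dvd_or_dvd h0).resolve_left fun h1 => ?_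
    obtain ⟨r, hr⟩ := h1
    have := congrArg (eval (fun _ : Var => (1 : K))) hr
    simp at this
  obtain ⟨r, hr⟩ := hdvd
  have huN : X f * X c2 * u ∈ N := by
    have h := mul_sub_aeval_mem N (X f * X c2) (bcZero K) (fun i => by
      cases i <;> simp only [bcZero, sub_self, mul_zero, sub_zero, zero_mem]
      · exact key _ (X f * X b3 ^ k) (by
          simp only [map_mul, map_pow]; linear_combination π (X f) * hz.s_mul_c2)
      · exact key _ (X c2 * X b3 ^ k * X b1 ^ (k + 1) * X f) (by
          simp only [map_mul, map_pow]
          linear_combination π (X f) * π (X c2) * (hz.eq_s1 + hz.s_mul_c1))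
      · exact key _ (X c2 * X b3 ^ k * X b4 ^ (k + 1) * X f) (by
          simp only [map_mul, map_pow]
          linear_combination π (X f) * π (X c2) * (hz.eq_f1 + hz.s_mul_c4))
      · exact key _ (X c2 * X b3 ^ k) (by
          simp only [map_mul, map_pow]; linear_combination π (X c2) * hz.f_mul_c1)
      · exact key _ (X c2 * X b3 ^ k) (by
          simp only [map_mul, map_pow]; linear_combination π (X c2) * hz.f_mul_c4)
      · exact key _ 1 (by simp only [map_mul, map_one]; linear_combination hz.eq_fcb)
      · exact key _ 1 (by simp only [map_mul, map_one]; ring)) u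
    have h' : X f * X c2 * aeval (bcZero K) u ∈ N := key _ 0 (by
      rw [hr]; simp only [map_mul, map_sub, map_zero]
      linear_combination π (X c2) * π r * hz.eq_fb)
    convert N.add_mem h h' using 1
    ring
  apply exists_sub_mul_mem_of_mem_comap
  convert N.add_mem (hker _ hu) huN using 1
  ring

theorem radical_le_reducedJ (hdd : d' ∣ d) (hd0 : 0 < d) {ζ : K} (hζ : IsPrimitiveRoot ζ d')
    (hI : reducedJ K d d' ≤ (J K d).radical) : (J K d).radical ≤ reducedJ K d d' := by
  intro g hg
  obtain ⟨w, hw⟩ := exists_sub_f_mul_c2_mul_b3_mem hd0 hI hg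
  have hd' : 0 < d' := Nat.pos_of_dvd_of_pos hdd hd0
  have hz := isZero_mk_reducedJ K d d'
  have h13 := mk_reducedJ_c3 K d d'
  have h14 := Ideal.Quotient.eq_zero_iff_mem.2
    (reducedJ_le_iff.1 (le_refl (reducedJ K d d'))).2.2
  set π := Ideal.Quotient.mk (reducedJ K d d') with hπ
  -- The generic point satisfies $J(1,d)$ once $b_1=\alpha b_3$, because $\alpha^d=1$. Cancelling
  -- $fc_2b_3$ gives one linear factor for each $\alpha$.
  have hdvd : X b1 ^ d' - X b3 ^ d' ∣ aeval (generic K d) w := by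
    rw [pow_sub_pow_eq_prod_algebraMap hd' hζ]
    refine prod_dvd_of_aeval_rotate _ fun α hα => ?_
    rw [Polynomial.mem_nthRootsFinset hd'] at hα
    have hαd : (C α : MvPolynomial Var K) ^ d = 1 := by
      obtain ⟨k, rfl⟩ := hdd
      rw [← map_pow, pow_mul, hα, one_pow, map_one]
    have h := (J K _).radical.sub_mem hg (hI hw)
    have h0 := aeval_eq_zero_of_mem_radical (v := fun i => aeval (rotate α) (generic K d i))
      (by constructor <;> simp [generic, rotate, mul_pow, hαd] <;> ring) h
    rw [← comp_aeval_apply] at h0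
    simpa [generic, rotate, X_ne_zero] using h0
  obtain ⟨r, hr⟩ := hdvd
  have h := mul_sub_aeval_mem (reducedJ K d d') (X f * X c2 * X b3) (generic K d) (fun i => by
    rw [← Ideal.Quotient.eq_zero_iff_mem, ← hπ]
    cases i <;> simp only [generic, sub_self, mul_zero, map_zero, map_mul, map_sub, map_pow]
    · linear_combination π (X f) * π (X b3) * hz.s_mul_c2
    · linear_combination π (X f) * π (X c2) * π (X b3) * hz.eq_s1 +
        π (X b3) * π (X s) * π (X c2) * hz.f_mul_c1 +
        π (X b3) * π (X f) * π (X c2) * π (X b3) ^ d * hz.s_mul_c2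
    · linear_combination π (X f) * π (X c2) * π (X b3) * hz.eq_f1 +
        π (X b3) * π (X s) * π (X c2) * hz.f_mul_c4 +
        π (X b3) * π (X f) * π (X c2) * π (X b3) ^ d * hz.s_mul_c2
    · linear_combination π (X c2) * π (X b3) * hz.f_mul_c1
    · linear_combination π (X c2) * h13
    · linear_combination π (X c2) * π (X b3) * hz.f_mul_c4
    · linear_combination π (X b3) * hz.eq_fcb
    · linear_combination - π (X b3) * hz.eq_fb - π (X b4) * h13) w
  -- The factor found is in $b_3$, while the generator of the enlarged ideal is in $b_2$; they agree
  -- after multiplication by $fc_2$.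
  have h' : X f * X c2 * X b3 * aeval (generic K d) w ∈ reducedJ K d d' := by
    rw [hr, ← Ideal.Quotient.eq_zero_iff_mem, ← hπ]
    simp only [map_mul, map_sub, map_pow] at h14 ⊢
    linear_combination π r * (h14 + π (X b3) * hz.f_mul_c2_mul_b2_pow d')
  convert Ideal.add_mem _ hw (Ideal.add_mem _ h h') using 1
  ring

end Radical

end MayrMeyer

theorem proposition5 (K : Type*) [Field K] (p : ℕ) [ExpChar K p]
    (d d' e : ℕ) (hd : 0 < d) (hd' : d = d' * p ^ e) (hcop : Nat.Coprime d' p)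
    (hroots : ∃ ζ : K, IsPrimitiveRoot ζ d') :
    (MayrMeyer.J K d).radical =
        MayrMeyer.J K d +
          Ideal.span {X MayrMeyer.Var.f * X MayrMeyer.Var.b3} *
            Ideal.span
              {X MayrMeyer.Var.c3 - X MayrMeyer.Var.c2,
                X MayrMeyer.Var.c2 *
                  (X MayrMeyer.Var.b1 ^ d' - X MayrMeyer.Var.b2 ^ d')} ∧
      (MayrMeyer.J K d).radical =
        (MayrMeyer.Q1 K).radical ⊓
          (⨅ α : {α : K // α ^ d' = 1}, (MayrMeyer.Q2 K d (p ^ e) α.1).radical) ⊓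
          (MayrMeyer.Q3 K).radical ⊓
          (MayrMeyer.Q4 K d).radical ⊓
          (MayrMeyer.Q5 K d).radical ⊓
          (MayrMeyer.Q6 K d).radical := by
  obtain ⟨ζ, hζ⟩ := hroots
  have hI := MayrMeyer.reducedJ_le_radical p hd' hd hζ
  exact ⟨le_antisymm (MayrMeyer.radical_le_reducedJ ⟨_, hd'⟩ hd hζ hI) hI,
    MayrMeyer.radical_J_eq_inf hd' hd hζ⟩
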